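/- An \emph{MV-algebra} is a structure $\mathbf A=\langle A,\oplus,\neg,0\rangle$ such that $\langle A,\oplus,0\rangle$ is a commutative monoid and, with $1:=\neg 0$, $\neg\neg x=x$, $x\oplus 1=1$ and $\neg(\neg x\oplus y)\oplus y=\neg(\neg y\oplus x)\oplus x$. Put $x\to y:=\neg x\oplus y$, $x*y:=\neg(\neg x\oplus\neg y)$; the relation $x\le y$ iff $x\to y=1$ is a bounded lattice order on $A$, with operations $\vee,\wedge$ and bounds $0,1$. A \emph{monadic MV-algebra} $\langle\mathbf A,\exists,\forall\rangle$ is an MV-algebra with two unary operations satisfying $\forall x\to x=1$, $\forall(x\to\forall y)=\exists x\to\forall y$, $\forall(\forall x\to y)=\forall x\to\forall y$, $\forall(\exists x\vee y)=\exists x\vee\forall y$ and $\exists(x*x)=\exists x*\exists x$. It is \emph{finitely subdirectly irreducible} (FSI) if its identity congruence is not the intersection of two congruences both different from the identity. For a natural number $k$ let $(W_k)$ be the identity $$\bigwedge_{1\le i<j\le k+1}\forall(x_i\vee x_j)\ \to\ \bigvee_{i=1}^{k+1}\forall x_i\ \approx\ 1 ;$$ for $k\ge 1$, the algebra has \emph{width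 $k$} if it satisfies $(W_k)$ but not $(W_{k-1})$. For a totally ordered MV-algebra $\mathbf V$, $\langle\mathbf V^k,\exists_\vee,\forall_\wedge\rangle$ is the monadic MV-algebra of $k$-tuples with pointwise MV-operations, where $\exists_\vee(f)$ and $\forall_\wedge(f)$ are the constant tuples with value $\max_i f(i)$ and $\min_i f(i)$ respectively. \textbf{Theorem.} Let $k\ge 1$ and let $\langle\mathbf A,\exists,\forall\rangle$ be a finitely subdirectly irreducible monadic MV-algebra of width $k$. Then there are a totally ordered MV-algebra $\mathbf V$ and an embedding (injective homomorphism of monadic MV-algebras) $\alpha\colon\langle\mathbf A,\exists,\forall\rangle\to\langle\mathbf V^k,\exists_\vee,\forall_\wedge\rangle$. -/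

import Mathlib

universe u

/-- An MV-algebra `⟨A, ⊕, ¬, 0⟩`, with `⊕` written `+` and `¬` written `ᶜ`.
The unit `1` of the algebra is `0ᶜ`. -/
class MVAlgebra (A : Type*) extends AddCommMonoid A, Compl A where
  compl_compl' : ∀ x : A, xᶜᶜ = x
  add_one' : ∀ x : A, x + 0ᶜ = 0ᶜ
  sup_comm' : ∀ x y : A, (xᶜ + y)ᶜ + y = (yᶜ + x)ᶜ + x

namespace MVAlgebra

variable {A : Type*} [MVAlgebra A]

/-- The implication `x → y`. -/
def imp (x y : A) : A := xᶜ + y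

/-- The product (strong conjunction) `x * y`. -/
def prod (x y : A) : A := (xᶜ + yᶜ)ᶜ

/-- The natural order: `x ≤ y` iff `x → y = 1`. -/
instance (priority := low) : LE A := ⟨fun x y => imp x y = 0ᶜ⟩

theorem le_iff {x y : A} : x ≤ y ↔ xᶜ + y = 0ᶜ := Iff.rfl

theorem compl_add_self (y : A) : yᶜ + y = 0ᶜ := by
  have h := sup_comm' (0ᶜ : A) y
  rwa [compl_compl', zero_add, add_one'] at h

theorem le_iff_exists {x y : A} : x ≤ y ↔ ∃ z, x + z = y := by
  constructor
  · intro h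
    have h1 := sup_comm' x y
    rw [le_iff.1 h, compl_compl', zero_add] at h1
    exact ⟨(yᶜ + x)ᶜ, by rw [add_comm]; exact h1.symm⟩
  · rintro ⟨z, rfl⟩
    rw [le_iff, ← add_assoc, compl_add_self, add_comm, add_one']

theorem compl_anti {x y : A} (h : x ≤ y) : yᶜ ≤ xᶜ := by
  rw [le_iff, compl_compl', add_comm]; exact h

theorem add_mono_right {x y : A} (h : x ≤ y) (z : A) : x + z ≤ y + z := by
  obtain ⟨w, rfl⟩ := le_iff_exists.1 h
  exact le_iff_exists.2 ⟨w, by rw [add_right_comm]⟩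

/-- The partial order of an MV-algebra. -/
instance (priority := low) instPartialOrder : PartialOrder A where
  le_refl := compl_add_self
  le_trans x y z h1 h2 := by
    obtain ⟨u, rfl⟩ := le_iff_exists.1 h1
    obtain ⟨v, rfl⟩ := le_iff_exists.1 h2
    exact le_iff_exists.2 ⟨u + v, by rw [add_assoc]⟩
  le_antisymm x y h1 h2 := by
    have h := sup_comm' x y
    rw [le_iff.1 h1, le_iff.1 h2, compl_compl', zero_add, zero_add] at h
    exact h.symm

theorem join_le {x y z : A} (h1 : x ≤ z) (h2 : y ≤ z) : (xᶜ + y)ᶜ + y ≤ z := by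
  have h3 := sup_comm' y z
  rw [le_iff.1 h2, compl_compl', zero_add] at h3
  calc (xᶜ + y)ᶜ + y ≤ (zᶜ + y)ᶜ + y :=
        add_mono_right (compl_anti (add_mono_right (compl_anti h1) y)) y
    _ = z := h3.symm

theorem le_join_right (x y : A) : y ≤ (xᶜ + y)ᶜ + y :=
  le_iff_exists.2 ⟨_, add_comm _ _⟩

theorem le_join_left (x y : A) : x ≤ (xᶜ + y)ᶜ + y := by
  rw [sup_comm']; exact le_join_right y x

/-- The lattice operations `x ∨ y = (x → y) → y` and `x ∧ y = ¬(¬x ∨ ¬y)`. -/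
instance (priority := low) instLattice : Lattice A where
  sup x y := (xᶜ + y)ᶜ + y
  inf x y := ((xᶜᶜ + yᶜ)ᶜ + yᶜ)ᶜ
  le_sup_left := le_join_left
  le_sup_right := le_join_right
  sup_le _ _ _ := join_le
  inf_le_left x y := by
    have h := compl_anti (le_join_left xᶜ yᶜ)
    rwa [compl_compl' x] at h ⊢
  inf_le_right x y := by
    have h := compl_anti (le_join_right xᶜ yᶜ)
    rwa [compl_compl' y] at h
  le_inf x y z h1 h2 := by
    have h := compl_anti (join_le (compl_anti h1) (compl_anti h2))
    rwa [compl_compl' x] at h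

/-- The bounds of an MV-algebra: `⊥ = 0` and `⊤ = 1 = ¬0`. -/
instance (priority := low) instBoundedOrder : BoundedOrder A where
  top := 0ᶜ
  bot := 0
  le_top x := by rw [le_iff, add_one']
  bot_le x := le_iff_exists.2 ⟨x, zero_add x⟩

/-- The power `A^X` with the pointwise operations. -/
instance instPi {X : Type*} : MVAlgebra (X → A) where
  compl_compl' f := funext fun x => compl_compl' (f x)
  add_one' f := funext fun x => add_one' (f x)
  sup_comm' f g := funext fun x => sup_comm' (f x) (g x)

end MVAlgebra

/-- A totally ordered MV-algebra. -/
class MVChain (V : Type*) extends MVAlgebra V where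
  le_total' : ∀ x y : V, x ≤ y ∨ y ≤ x

open MVAlgebra in
/-- A monadic MV-algebra `⟨A, ∃, ∀⟩`, with `∃` written `ex` and `∀` written `all`. -/
class MonadicMVAlgebra (A : Type*) extends MVAlgebra A where
  ex : A → A
  all : A → A
  m1 : ∀ x : A, imp (all x) x = 0ᶜ
  m2 : ∀ x y : A, all (imp x (all y)) = imp (ex x) (all y)
  m3 : ∀ x y : A, all (imp (all x) y) = imp (all x) (all y)
  m4 : ∀ x y : A, all (ex x ⊔ y) = ex x ⊔ all y
  m5 : ∀ x : A, ex (prod x x) = prod (ex x) (ex x)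

/-- Congruences of a monadic MV-algebra. -/
structure MonadicMVCongruence (A : Type*) [MonadicMVAlgebra A] extends Setoid A where
  add' : ∀ {a b c d : A}, r a b → r c d → r (a + c) (b + d)
  compl' : ∀ {a b : A}, r a b → r aᶜ bᶜ
  ex' : ∀ {a b : A}, r a b → r (MonadicMVAlgebra.ex a) (MonadicMVAlgebra.ex b)
  all' : ∀ {a b : A}, r a b → r (MonadicMVAlgebra.all a) (MonadicMVAlgebra.all b)

/-- An injective homomorphism of monadic MV-algebras. -/
structure MonadicMVEmbedding (A B : Type*) [MonadicMVAlgebra A] [MonadicMVAlgebra B] where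
  toFun : A → B
  injective' : Function.Injective toFun
  map_zero' : toFun 0 = 0
  map_add' : ∀ a b : A, toFun (a + b) = toFun a + toFun b
  map_compl' : ∀ a : A, toFun aᶜ = (toFun a)ᶜ
  map_ex' : ∀ a : A, toFun (MonadicMVAlgebra.ex a) = MonadicMVAlgebra.ex (toFun a)
  map_all' : ∀ a : A, toFun (MonadicMVAlgebra.all a) = MonadicMVAlgebra.all (toFun a)

namespace MonadicMVAlgebra

open MVAlgebra

section width

variable (A : Type*) [MonadicMVAlgebra A]

/-- Finitely subdirectly irreducible: the identity congruence is not the intersection of two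
congruences that are both different from it. -/
def IsFSI : Prop :=
  ∀ θ φ : MonadicMVCongruence A, (∀ a b : A, θ.r a b ∧ φ.r a b → a = b) →
    (∀ a b : A, θ.r a b → a = b) ∨ (∀ a b : A, φ.r a b → a = b)

/-- The identity `(W_k)`:
`⋀_{1 ≤ i < j ≤ k+1} ∀(x_i ∨ x_j) → ⋁_{i=1}^{k+1} ∀ x_i ≈ 1`. -/
def SatisfiesW (k : ℕ) : Prop :=
  ∀ x : Fin (k + 1) → A,
    imp ((Finset.univ.filter fun p : Fin (k + 1) × Fin (k + 1) => p.1 < p.2).inf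
        fun p => all (x p.1 ⊔ x p.2))
      (Finset.univ.sup fun i => all (x i)) = 0ᶜ

/-- Width `k`, for `k ≥ 1`: `(W_k)` holds and `(W_{k-1})` fails. -/
def HasWidth (k : ℕ) : Prop := SatisfiesW A k ∧ ¬ SatisfiesW A (k - 1)

end width

section power

variable {X V : Type*} [Fintype X]

/-- `∃_∨ f` is the constant function with value the join of the values of `f`. -/
def existsSup [MVAlgebra V] (f : X → V) : X → V := fun _ => Finset.univ.sup f

/-- `∀_∧ f` is the constant function with value the meet of the values of `f`. -/
def forallInf [MVAlgebra V] (f : X → V) : X → V := fun _ => Finset.univ.inf f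

theorem existsSup_attained [MVChain V] (f : X → V) (x : X) :
    ∃ x₀, (∀ y, f y ≤ f x₀) ∧ ∀ z, existsSup f z = f x₀ := by
  obtain ⟨x₀, hx₀⟩ := (Set.finite_univ (α := X)).exists_maximalFor f _ ⟨x, trivial⟩
  have h : ∀ y, f y ≤ f x₀ := fun y =>
    (MVChain.le_total' (f y) (f x₀)).elim id fun h => hx₀.2 trivial h
  exact ⟨x₀, h, fun _ => le_antisymm (Finset.sup_le fun y _ => h y)
    (Finset.le_sup (f := f) (Finset.mem_univ x₀))⟩

theorem forallInf_attained [MVChain V] (f : X → V) (x : X) :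
    ∃ x₀, (∀ y, f x₀ ≤ f y) ∧ ∀ z, forallInf f z = f x₀ := by
  obtain ⟨x₀, hx₀⟩ := (Set.finite_univ (α := X)).exists_minimalFor f _ ⟨x, trivial⟩
  have h : ∀ y, f x₀ ≤ f y := fun y =>
    (MVChain.le_total' (f x₀) (f y)).elim id fun h => hx₀.2 trivial h
  exact ⟨x₀, h, fun _ => le_antisymm (Finset.inf_le (f := f) (Finset.mem_univ x₀))
    (Finset.le_inf fun y _ => h y)⟩

theorem existsSup_eq [MVChain V] {f : X → V} {x₀ : X} (h : ∀ y, f y ≤ f x₀) (z : X) :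
    existsSup f z = f x₀ :=
  le_antisymm (Finset.sup_le fun y _ => h y) (Finset.le_sup (f := f) (Finset.mem_univ x₀))

theorem forallInf_eq [MVChain V] {f : X → V} {x₀ : X} (h : ∀ y, f x₀ ≤ f y) (z : X) :
    forallInf f z = f x₀ :=
  le_antisymm (Finset.inf_le (f := f) (Finset.mem_univ x₀)) (Finset.le_inf fun y _ => h y)

/-- The algebra `⟨V^X, ∃_∨, ∀_∧⟩` for a totally ordered MV-algebra `V` and a finite set `X`. -/
instance instPower [MVChain V] : MonadicMVAlgebra (X → V) where
  ex := existsSup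
  all := forallInf
  m1 f := funext fun x => by
    show forallInf f x ≤ f x
    exact Finset.inf_le (f := f) (Finset.mem_univ x)
  m2 f g := funext fun x => by
    obtain ⟨x₀, h, e⟩ := existsSup_attained f x
    obtain ⟨x₁, -, e'⟩ := forallInf_attained g x
    rw [forallInf_eq (x₀ := x₀)]
    · show (f x₀)ᶜ + forallInf g x₀ = (existsSup f x)ᶜ + forallInf g x
      rw [e, e', e']
    · intro y
      show (f x₀)ᶜ + forallInf g x₀ ≤ (f y)ᶜ + forallInf g y
      rw [e', e']
      exact add_mono_right (compl_anti (h y)) _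
  m3 f g := funext fun x => by
    obtain ⟨x₀, h, e⟩ := forallInf_attained g x
    obtain ⟨x₁, -, e'⟩ := forallInf_attained f x
    rw [forallInf_eq (x₀ := x₀)]
    · show (forallInf f x₀)ᶜ + g x₀ = (forallInf f x)ᶜ + forallInf g x
      rw [e, e', e']
    · intro y
      show (forallInf f x₀)ᶜ + g x₀ ≤ (forallInf f y)ᶜ + g y
      rw [e', e', add_comm, add_comm _ (g y)]
      exact add_mono_right (h y) _
  m4 f g := funext fun x => by
    obtain ⟨x₀, h, e⟩ := forallInf_attained g x
    obtain ⟨x₁, -, e'⟩ := existsSup_attained f x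
    rw [forallInf_eq (x₀ := x₀)]
    · show existsSup f x₀ ⊔ g x₀ = existsSup f x ⊔ forallInf g x
      rw [e, e', e']
    · intro y
      show existsSup f x₀ ⊔ g x₀ ≤ existsSup f y ⊔ g y
      rw [e', e']
      exact sup_le_sup_left (h y) _
  m5 f := funext fun x => by
    obtain ⟨x₀, h, e⟩ := existsSup_attained f x
    rw [existsSup_eq (x₀ := x₀)]
    · show ((f x₀)ᶜ + (f x₀)ᶜ)ᶜ = ((existsSup f x)ᶜ + (existsSup f x)ᶜ)ᶜ
      rw [e]
    · intro y
      show ((f y)ᶜ + (f y)ᶜ)ᶜ ≤ ((f x₀)ᶜ + (f x₀)ᶜ)ᶜ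
      have h1 := compl_anti (h y)
      refine compl_anti (le_trans (add_mono_right h1 _) ?_)
      rw [add_comm]
      exact add_mono_right h1 _

end power

end MonadicMVAlgebra

/-! Call an element constant if `∀` fixes it. Finite subdirect irreducibility makes the constants a
chain: for constants c, d the elements c - d and d - c are disjoint and generate two congruences
that meet in the identity (`IsFSI.isConst_total`).

A null ideal is one on which `∀` vanishes; it meets the constants only in 0, so the constants embed
in the quotient. A maximal null ideal is prime because the constants form a chain
(`IsFSI.maximal_prime`), so its quotient is totally ordered. There are at most k of them: k + 1
would be separated by pairwise disjoint elements, whose complements refute the identity of width k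
(`IsFSI.not_injective_maximal`).

The at most k quotient chains are amalgamated over the constants into one chain V
(`exists_mvChain_amalgam`). For this, chains are replaced by their Chang groups, ordered abelian
groups are amalgamated, and a unit interval is taken. Sending a to the tuple of its classes gives a
map to the k-th power of V that makes constants into constant tuples. It preserves `∀` because a -
∀a has `∀` equal to 0 (`all_sub_all`), hence lies in some maximal null ideal, and at that coordinate
the minimum ∀a is attained. Injectivity follows since ∀ detects 1 and constants embed in every
quotient. -/

namespace MVAlgebra

/-! ### Arithmetic of MV-algebras: truncated difference, disjointness, product -/

section basic

variable {A : Type*} [MVAlgebra A]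

theorem compl_compl_eq (x : A) : xᶜᶜ = x := compl_compl' x

theorem add_one_eq (x : A) : x + 0ᶜ = 0ᶜ := add_one' x

/-- Truncated difference. -/
instance (priority := low) instSub : Sub A := ⟨fun x y => (xᶜ + y)ᶜ⟩

theorem sub_def (x y : A) : x - y = (xᶜ + y)ᶜ := rfl

instance (priority := low) instIsOrderedAddMonoid : IsOrderedAddMonoid A where
  add_le_add_left _ _ h c := add_mono_right h c

instance (priority := low) instOrderedSub : OrderedSub A where
  tsub_le_iff_right x y z := by
    rw [le_iff, le_iff, sub_def, compl_compl_eq, add_assoc, add_comm y z]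

instance (priority := low) instCanonicallyOrderedAdd : CanonicallyOrderedAdd A where
  exists_add_of_le h := by
    obtain ⟨z, hz⟩ := le_iff_exists.1 h
    exact ⟨z, hz.symm⟩
  le_self_add x y := le_iff_exists.2 ⟨y, rfl⟩
  le_add_self x y := le_iff_exists.2 ⟨y, add_comm _ _⟩

theorem le_one (x : A) : x ≤ 0ᶜ := le_top

theorem compl_inj' {x y : A} : xᶜ = yᶜ ↔ x = y := by
  refine ⟨fun h => ?_, fun h => h ▸ rfl⟩
  rw [← compl_compl_eq x, h, compl_compl_eq]

theorem one_le_iff {x : A} : 0ᶜ ≤ x ↔ x = 0ᶜ :=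
  ⟨fun h => le_antisymm (le_one x) h, fun h => h ▸ le_rfl⟩

theorem compl_le_iff_add_eq {x y : A} : xᶜ ≤ y ↔ x + y = 0ᶜ := by
  rw [le_iff, compl_compl_eq]

theorem compl_le_add_iff {x y e : A} : yᶜ ≤ xᶜ + e ↔ x ≤ y + e := by
  rw [le_iff, le_iff, compl_compl_eq, add_left_comm]

theorem sub_le_compl (x y : A) : x - y ≤ yᶜ := compl_anti (le_iff_exists.2 ⟨xᶜ, add_comm _ _⟩)

/-- Cancellation of a sum that does not overflow. -/
theorem add_sub_cancel_of_le_compl {x y : A} (h : x ≤ yᶜ) : x + y - y = x := by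
  have h1 := sup_comm' xᶜ y
  rw [compl_compl_eq, add_comm yᶜ, (le_iff.1 h : xᶜ + yᶜ = 0ᶜ), compl_compl_eq, zero_add] at h1
  rw [sub_def, h1, compl_compl_eq]

/-- Addition of a is the upper adjoint of subtraction of a, so it preserves meets. -/
theorem add_inf_eq (a b c : A) : a + b ⊓ c = (a + b) ⊓ (a + c) := by
  refine le_antisymm (le_inf (add_le_add_right inf_le_left a) (add_le_add_right inf_le_right a)) ?_
  rw [← tsub_le_iff_left]
  exact le_inf (tsub_le_iff_left.2 inf_le_left) (tsub_le_iff_left.2 inf_le_right)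

theorem inf_add_le (x y z : A) : x ⊓ (y + z) ≤ x ⊓ y + x ⊓ z := by
  rw [add_inf_eq (x ⊓ y) x z, add_comm (x ⊓ y) x, add_comm (x ⊓ y) z, add_inf_eq x x y,
    add_inf_eq z x y, add_comm z y]
  refine le_inf (le_inf ?_ ?_) (le_inf ?_ ?_)
  · exact inf_le_left.trans le_self_add
  · exact inf_le_left.trans le_self_add
  · exact inf_le_left.trans le_add_self
  · exact inf_le_right

theorem inf_nsmul_eq_zero {x y : A} (h : x ⊓ y = 0) (n : ℕ) : x ⊓ n • y = 0 := by
  induction n with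
  | zero => rw [zero_nsmul]; exact le_antisymm inf_le_right zero_le
  | succ n ih =>
    rw [succ_nsmul]
    refine le_antisymm ((inf_add_le _ _ _).trans ?_) zero_le
    rw [ih, h, add_zero]

theorem nsmul_inf_nsmul_eq_zero {x y : A} (h : x ⊓ y = 0) (m n : ℕ) : m • x ⊓ n • y = 0 := by
  rw [inf_comm]
  refine inf_nsmul_eq_zero ?_ m
  rw [inf_comm]
  exact inf_nsmul_eq_zero h n

/-- Adding x - y to x ⊓ y stays below x, and adding y - x stays below y. So the meet of the
differences can be added to x ⊓ y without increasing it; that sum does not overflow, and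
cancellation applies. -/
theorem sub_inf_sub_eq_zero (x y : A) : (x - y) ⊓ (y - x) = 0 := by
  have h1 : x ⊓ y + (x - y) ≤ x := by
    refine (add_le_add_right (tsub_le_tsub_left (inf_le_right (a := x)) x) _).trans ?_
    rw [add_tsub_cancel_of_le inf_le_left]
  have h2 : x ⊓ y + (y - x) ≤ y := by
    refine (add_le_add_right (tsub_le_tsub_left (inf_le_left (b := y)) y) _).trans ?_
    rw [add_tsub_cancel_of_le inf_le_right]
  have h3 : (x - y) ⊓ (y - x) + x ⊓ y ≤ x ⊓ y := by
    rw [add_comm, add_inf_eq]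
    exact inf_le_inf h1 h2
  have h4 : (x - y) ⊓ (y - x) ≤ (x ⊓ y)ᶜ :=
    inf_le_left.trans ((sub_le_compl x y).trans (compl_anti inf_le_right))
  rw [← add_sub_cancel_of_le_compl h4]
  exact le_antisymm (tsub_le_iff_right.2 (by rwa [zero_add])) zero_le

theorem eq_zero_of_one_eq_zero (h : (0ᶜ : A) = 0) (x : A) : x = 0 :=
  le_antisymm (h ▸ le_one x) zero_le

/-- The product `x * y` as a truncated difference. -/
theorem prod_eq_sub (x y : A) : prod x y = x - yᶜ := rfl

theorem prod_comm (x y : A) : prod x y = prod y x := by rw [prod, prod, add_comm]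

theorem prod_le_left (x y : A) : prod x y ≤ x := tsub_le_self

theorem prod_assoc (x y z : A) : prod (prod x y) z = prod x (prod y z) := by
  simp only [prod, compl_compl_eq, add_assoc]

theorem compl_prod (x y : A) : (prod x y)ᶜ = xᶜ + yᶜ := compl_compl_eq _

theorem compl_add' (x y : A) : (x + y)ᶜ = prod xᶜ yᶜ := by
  simp only [prod, compl_compl_eq]

/-- When a sum reaches 1, the product plays the role of a + b - 1. This and the next two lemmas are
the cases of associativity in the Chang group, according to which of a + b and b + c overflow. -/
theorem prod_add_eq_prod_add {a b c : A} (hab : a ≤ bᶜ) (hbc : b ≤ cᶜ) :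
    prod (a + b) c = prod a (b + c) := by
  have h : cᶜ = b + (cᶜ - b) := (add_tsub_cancel_of_le hbc).symm
  rw [prod_eq_sub, prod_eq_sub, h, ← tsub_tsub, add_sub_cancel_of_le_compl hab, sub_def cᶜ b,
    compl_compl_eq, add_comm b c]

theorem prod_add_eq_add_prod {a b c : A} (hab : a ≤ bᶜ) (hbc : cᶜ ≤ b) :
    prod (a + b) c = a + prod b c := by
  have h : b = (b - cᶜ) + cᶜ := (tsub_add_cancel_of_le hbc).symm
  have h2 : a + (b - cᶜ) ≤ cᶜᶜ := by
    have h3 : bᶜ = cᶜᶜ - (b - cᶜ) := by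
      rw [sub_def cᶜᶜ, compl_compl_eq, compl_inj', add_comm]; exact h
    refine (add_le_add_left hab _).trans ?_
    rw [h3, tsub_add_cancel_of_le (sub_le_compl b cᶜ)]
  rw [prod_eq_sub, prod_eq_sub]
  conv_lhs => rw [h, ← add_assoc]
  exact add_sub_cancel_of_le_compl h2

theorem prod_add_eq_add_prod' {a b c : A} (hab : a + b = 0ᶜ) (hbc : b + c = 0ᶜ) :
    prod a b + c = a + prod b c := by
  have h := prod_add_eq_prod_add (a := aᶜ) (b := bᶜ) (c := cᶜ)
    (by rwa [compl_compl_eq, compl_le_iff_add_eq]) (by rwa [compl_compl_eq, compl_le_iff_add_eq])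
  rw [← compl_inj', compl_add', compl_add', compl_prod, compl_prod, h]

end basic
end MVAlgebra

/-! ### The Chang group of a totally ordered MV-algebra -/

namespace MVAlgebra

/-- The underlying set of the Chang group of a totally ordered MV-algebra: a pair `(m, a)`, `a ≠ 1`,
stands for `m • 1 + a`. -/
@[ext]
structure ChangGroup (A : Type*) [MVAlgebra A] where
  fst : ℤ
  snd : A
  ne : snd ≠ 0ᶜ

theorem MVChain.le_total {A : Type*} [MVChain A] (x y : A) : x ≤ y ∨ y ≤ x := MVChain.le_total' x y

section chain

variable {A : Type*} [MVChain A] {a b : A}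

theorem le_compl_of_add_ne (h : a + b ≠ 0ᶜ) : a ≤ bᶜ := by
  refine (MVChain.le_total a bᶜ).resolve_right fun h1 => h ?_
  rw [add_comm]
  exact compl_le_iff_add_eq.1 h1

theorem prod_ne_one (ha : a ≠ 0ᶜ) (b : A) : prod a b ≠ 0ᶜ := fun h =>
  ha (one_le_iff.1 (h ▸ prod_le_left a b))

namespace ChangGroup

open Classical in
noncomputable instance : Add (ChangGroup A) where
  add x y :=
    if h : x.snd + y.snd = 0ᶜ then ⟨x.fst + y.fst + 1, prod x.snd y.snd, prod_ne_one x.ne _⟩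
    else ⟨x.fst + y.fst, x.snd + y.snd, h⟩

theorem add_of_eq {x y : ChangGroup A} (h : x.snd + y.snd = 0ᶜ) :
    x + y = ⟨x.fst + y.fst + 1, prod x.snd y.snd, prod_ne_one x.ne _⟩ := dif_pos h

theorem add_of_ne {x y : ChangGroup A} (h : x.snd + y.snd ≠ 0ᶜ) :
    x + y = ⟨x.fst + y.fst, x.snd + y.snd, h⟩ := dif_neg h

protected theorem add_comm (x y : ChangGroup A) : x + y = y + x := by
  by_cases h : x.snd + y.snd = 0ᶜ
  · rw [add_of_eq h, add_of_eq (by rwa [add_comm])]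
    ext
    · simp only [add_comm]
    · exact prod_comm _ _
  · rw [add_of_ne h, add_of_ne (by rwa [add_comm])]
    ext <;> simp only [add_comm]

/-- The case without a carry from x + y; commutativity transfers it to the case without a carry from
y + z, leaving only two carries for `ChangGroup.add_assoc`. -/
theorem add_assoc_of_ne {x y z : ChangGroup A} (hxy : x.snd + y.snd ≠ 0ᶜ) :
    x + y + z = x + (y + z) := by
  rw [add_of_ne hxy]
  by_cases hyz : y.snd + z.snd = 0ᶜ
  · have h : x.snd + y.snd + z.snd = 0ᶜ := by rw [add_assoc, hyz, add_one_eq]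
    have h1 : prod (x.snd + y.snd) z.snd = x.snd + prod y.snd z.snd :=
      prod_add_eq_add_prod (le_compl_of_add_ne hxy)
        (compl_le_iff_add_eq.2 (by rwa [add_comm]))
    have h2 : x.snd + prod y.snd z.snd ≠ 0ᶜ := h1 ▸ prod_ne_one hxy _
    rw [add_of_eq hyz, add_of_eq h, add_of_ne h2]
    ext
    · simp only [add_assoc]
    · exact h1
  · rw [add_of_ne hyz]
    by_cases h : x.snd + y.snd + z.snd = 0ᶜ
    · rw [add_of_eq h, add_of_eq (by rwa [← add_assoc])]
      ext
      · simp only [add_assoc]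
      · exact prod_add_eq_prod_add (le_compl_of_add_ne hxy) (le_compl_of_add_ne hyz)
    · rw [add_of_ne h, add_of_ne (by rwa [← add_assoc])]
      ext <;> simp only [add_assoc]

protected theorem add_assoc (x y z : ChangGroup A) : x + y + z = x + (y + z) := by
  by_cases hxy : x.snd + y.snd = 0ᶜ
  · by_cases hyz : y.snd + z.snd = 0ᶜ
    · have h1 := prod_add_eq_add_prod' hxy hyz
      rw [add_of_eq hxy, add_of_eq hyz]
      by_cases h : prod x.snd y.snd + z.snd = 0ᶜ
      · rw [add_of_eq h, add_of_eq (h1 ▸ h)]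
        ext
        · simp only []; ring
        · exact prod_assoc _ _ _
      · rw [add_of_ne h, add_of_ne (h1 ▸ h)]
        ext
        · simp only []; ring
        · exact h1
    · rw [ChangGroup.add_comm x (y + z), ChangGroup.add_comm y z,
        add_assoc_of_ne (x := z) (y := y) (by rwa [add_comm]), ChangGroup.add_comm y x,
        ChangGroup.add_comm z]
  · exact add_assoc_of_ne hxy

theorem fst_add_fst_le (x y : ChangGroup A) : x.fst + y.fst ≤ (x + y).fst := by
  by_cases h : x.snd + y.snd = 0ᶜ
  · rw [add_of_eq h]; exact (lt_add_one _).le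
  · rw [add_of_ne h]

variable [Nontrivial A]

theorem zero_ne_one' : (0 : A) ≠ 0ᶜ := fun h => by
  obtain ⟨x, y, hxy⟩ := exists_pair_ne A
  exact hxy ((eq_zero_of_one_eq_zero h.symm x).trans (eq_zero_of_one_eq_zero h.symm y).symm)

instance : Zero (ChangGroup A) := ⟨⟨0, 0, zero_ne_one'⟩⟩

theorem zero_fst : (0 : ChangGroup A).fst = 0 := rfl
open Classical in
noncomputable instance : Neg (ChangGroup A) where
  neg x :=
    if h : x.snd = 0 then ⟨-x.fst, 0, zero_ne_one'⟩
    else ⟨-x.fst - 1, x.sndᶜ, fun h1 => h (compl_inj'.1 h1)⟩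

theorem neg_of_eq {x : ChangGroup A} (h : x.snd = 0) : -x = ⟨-x.fst, 0, zero_ne_one'⟩ := dif_pos h

theorem neg_of_ne {x : ChangGroup A} (h : x.snd ≠ 0) :
    -x = ⟨-x.fst - 1, x.sndᶜ, fun h1 => h (compl_inj'.1 h1)⟩ := dif_neg h

protected theorem zero_add (x : ChangGroup A) : 0 + x = x := by
  have h : (0 : ChangGroup A).snd + x.snd = x.snd := zero_add _
  rw [add_of_ne (h.symm ▸ x.ne)]
  ext
  · exact zero_add _
  · exact h

protected theorem neg_add_cancel (x : ChangGroup A) : -x + x = 0 := by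
  by_cases h : x.snd = 0
  · have h1 : (0 : A) + x.snd = 0 := by rw [h, add_zero]
    rw [neg_of_eq h, add_of_ne (ne_of_eq_of_ne h1 zero_ne_one')]
    ext
    · exact neg_add_cancel _
    · exact h1
  · rw [neg_of_ne h, add_of_eq (compl_add_self _)]
    ext
    · simp only [zero_fst]; ring
    · show (x.sndᶜᶜ + x.sndᶜ)ᶜ = 0
      rw [compl_add_self, compl_compl_eq]

noncomputable instance : AddCommGroup (ChangGroup A) where
  add_assoc := ChangGroup.add_assoc
  zero_add := ChangGroup.zero_add
  add_zero x := by rw [ChangGroup.add_comm, ChangGroup.zero_add]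
  neg_add_cancel := ChangGroup.neg_add_cancel
  add_comm := ChangGroup.add_comm
  nsmul := nsmulRec
  zsmul := zsmulRec

/-- The elements `(m, a)` with `0 ≤ m`. -/
def nonneg (A : Type*) [MVChain A] [Nontrivial A] : AddGroupCone (ChangGroup A) where
  carrier := {x | 0 ≤ x.fst}
  zero_mem' := le_refl (0 : ℤ)
  add_mem' {x y} hx hy := (add_nonneg hx hy).trans (fst_add_fst_le x y)
  eq_zero_of_mem_of_neg_mem' {x} hx hy := by
    by_cases h : x.snd = 0
    · rw [neg_of_eq h] at hy
      ext
      · exact le_antisymm (neg_nonneg.1 hy) hx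
      · exact h
    · rw [neg_of_ne h] at hy
      simp only [Set.mem_ofPred_eq] at hx hy
      omega

theorem mem_nonneg {x : ChangGroup A} : x ∈ nonneg A ↔ 0 ≤ x.fst := Iff.rfl

instance : HasMemOrNegMem (nonneg A) where
  mem_or_neg_mem x := by
    refine or_iff_not_imp_left.2 fun h => ?_
    rw [mem_nonneg] at h ⊢
    by_cases h1 : x.snd = 0
    · rw [neg_of_eq h1]; simp only; omega
    · rw [neg_of_ne h1]; simp only; omega

open Classical in
noncomputable instance : LinearOrder (ChangGroup A) := LinearOrder.mkOfAddGroupCone (nonneg A)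

instance : IsOrderedAddMonoid (ChangGroup A) := IsOrderedAddMonoid.mkOfCone (nonneg A)

end ChangGroup
end chain
end MVAlgebra

/-! ### Functoriality of the Chang group; unit intervals of ordered groups -/

namespace MVAlgebra

/-- An injective homomorphism of MV-algebras. -/
structure Embedding (A B : Type*) [MVAlgebra A] [MVAlgebra B] where
  toFun : A → B
  injective : Function.Injective toFun
  map_zero : toFun 0 = 0
  map_add : ∀ a b, toFun (a + b) = toFun a + toFun b
  map_compl : ∀ a, toFun aᶜ = (toFun a)ᶜ

namespace Embedding

variable {A B : Type*} [MVAlgebra A] [MVAlgebra B] (f : Embedding A B)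

theorem map_one : f.toFun 0ᶜ = 0ᶜ := by rw [f.map_compl, f.map_zero]

theorem map_ne_one {a : A} (h : a ≠ 0ᶜ) : f.toFun a ≠ 0ᶜ := fun h1 =>
  h (f.injective (h1.trans f.map_one.symm))

end Embedding

namespace ChangGroup

variable {A B : Type*} [MVChain A] [MVChain B] [Nontrivial A] [Nontrivial B]

theorem nonneg_iff {x : ChangGroup A} : 0 ≤ x ↔ 0 ≤ x.fst := by
  show x - 0 ∈ nonneg A ↔ _
  rw [sub_zero, mem_nonneg]

/-- The strong unit `(1, 0)`. -/
def unit (A : Type*) [MVChain A] [Nontrivial A] : ChangGroup A := ⟨1, 0, zero_ne_one'⟩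

open Classical in
/-- The embedding of a totally ordered MV-algebra into its Chang group. -/
noncomputable def of (a : A) : ChangGroup A := if h : a = 0ᶜ then unit A else ⟨0, a, h⟩

theorem of_one : of (0ᶜ : A) = unit A := dif_pos rfl

theorem of_of_ne {a : A} (h : a ≠ 0ᶜ) : of a = ⟨0, a, h⟩ := dif_neg h

theorem of_zero : of (0 : A) = 0 := of_of_ne zero_ne_one'

theorem of_injective : Function.Injective (of : A → ChangGroup A) := by
  intro a b h
  by_cases ha : a = 0ᶜ <;> by_cases hb : b = 0ᶜ
  · rw [ha, hb]
  · rw [ha, of_one, of_of_ne hb] at h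
    exact absurd (congrArg fst h) one_ne_zero
  · rw [hb, of_one, of_of_ne ha] at h
    exact absurd (congrArg fst h) zero_ne_one
  · rw [of_of_ne ha, of_of_ne hb] at h
    exact congrArg snd h

theorem of_nonneg (a : A) : 0 ≤ of a := by
  rw [nonneg_iff]
  by_cases ha : a = 0ᶜ
  · rw [ha, of_one]; exact zero_le_one
  · rw [of_of_ne ha]

theorem of_add_of_ne {a b : A} (h : a + b ≠ 0ᶜ) : of (a + b) = of a + of b := by
  have ha : a ≠ 0ᶜ := fun ha => h (by rw [ha, add_comm, add_one_eq])
  have hb : b ≠ 0ᶜ := fun hb => h (by rw [hb, add_one_eq])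
  rw [of_of_ne h, of_of_ne ha, of_of_ne hb]
  exact (add_of_ne (x := ⟨0, a, ha⟩) (y := ⟨0, b, hb⟩) h).symm

theorem unit_le_of_add {a b : A} (h : a + b = 0ᶜ) : unit A ≤ of a + of b := by
  by_cases ha : a = 0ᶜ
  · rw [ha, of_one]; exact le_add_of_nonneg_right (of_nonneg b)
  by_cases hb : b = 0ᶜ
  · rw [hb, of_one]; exact le_add_of_nonneg_left (of_nonneg a)
  have h1 : of a + of b = unit A + of (prod a b) := by
    have h2 : (unit A).snd + prod a b ≠ 0ᶜ := by
      rw [show (unit A).snd = 0 from rfl, zero_add]; exact prod_ne_one ha b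
    rw [of_of_ne ha, of_of_ne hb, of_of_ne (prod_ne_one ha b),
      add_of_eq (x := ⟨0, a, ha⟩) (y := ⟨0, b, hb⟩) h, add_of_ne h2]
    ext
    · rfl
    · exact (zero_add _).symm
  rw [h1]
  exact le_add_of_nonneg_right (of_nonneg _)

theorem of_compl (a : A) : of aᶜ = unit A - of a := by
  rw [eq_sub_iff_add_eq]
  by_cases ha : a = 0ᶜ
  · rw [ha, of_one, compl_compl_eq, of_zero, zero_add]
  by_cases ha0 : a = 0
  · rw [ha0, of_one, of_zero, add_zero]
  have hc : aᶜ ≠ 0ᶜ := fun h => ha0 (compl_inj'.1 h)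
  rw [of_of_ne ha, of_of_ne hc, add_of_eq (x := ⟨0, aᶜ, hc⟩) (y := ⟨0, a, ha⟩) (compl_add_self a)]
  ext
  · rfl
  · show (aᶜᶜ + aᶜ)ᶜ = 0
    rw [compl_add_self, compl_compl_eq]

theorem of_le_unit (a : A) : of a ≤ unit A := by
  rw [← sub_nonneg, ← of_compl]
  exact of_nonneg _

/-- With `of_compl`, this says that the operations of the chain are those of the unit interval of
its Chang group. -/
theorem of_add (a b : A) : of (a + b) = min (unit A) (of a + of b) := by
  by_cases h : a + b = 0ᶜ
  · rw [min_eq_left (unit_le_of_add h), h, of_one]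
  · rw [← of_add_of_ne h, min_eq_right (of_le_unit _)]

/-- The homomorphism of Chang groups induced by an embedding of MV-chains. -/
noncomputable def map (f : Embedding A B) : ChangGroup A →+ ChangGroup B :=
  AddMonoidHom.mk' (fun x => ⟨x.fst, f.toFun x.snd, f.map_ne_one x.ne⟩) fun x y => by
    by_cases h : x.snd + y.snd = 0ᶜ
    · rw [add_of_eq h, add_of_eq (by rw [← f.map_add, h, f.map_one])]
      ext
      · rfl
      · simp only [prod, f.map_compl, f.map_add]
    · rw [add_of_ne h, add_of_ne (by rw [← f.map_add]; exact f.map_ne_one h)]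
      ext
      · rfl
      · exact f.map_add _ _

theorem map_of (f : Embedding A B) (a : A) : map f (of a) = of (f.toFun a) := by
  by_cases h : a = 0ᶜ
  · rw [h, f.map_one, of_one, of_one]
    ext
    · rfl
    · exact f.map_zero
  · rw [of_of_ne h, of_of_ne (f.map_ne_one h)]
    rfl

/-- Positivity depends only on the integer coordinate, which `map` leaves unchanged. -/
theorem map_strictMono (f : Embedding A B) : StrictMono (map f) := by
  refine Monotone.strictMono_of_injective (fun x y h => ?_) fun x y h => ?_
  · rw [← sub_nonneg, ← map_sub, nonneg_iff]
    exact (nonneg_iff (x := y - x)).1 (sub_nonneg.2 h)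
  · have h1 : f.toFun x.snd = f.toFun y.snd := congrArg (fun z : ChangGroup B => z.snd) h
    have h2 : x.fst = y.fst := congrArg (fun z : ChangGroup B => z.fst) h
    ext
    · exact h2
    · exact f.injective h1

end ChangGroup

/-- The unit interval `[0, u]` of an ordered group. -/
@[ext]
structure UnitInterval (G : Type*) [AddCommGroup G] [LinearOrder G] (u : G) where
  val : G
  nonneg : 0 ≤ val
  le : val ≤ u

namespace UnitInterval

variable {G : Type*} [AddCommGroup G] [LinearOrder G] [IsOrderedAddMonoid G] {u : G}

instance : Add (UnitInterval G u) where
  add x y := ⟨min u (x.val + y.val), le_min (x.nonneg.trans x.le) (add_nonneg x.nonneg y.nonneg),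
    min_le_left _ _⟩

instance : Compl (UnitInterval G u) where
  compl x := ⟨u - x.val, sub_nonneg.2 x.le, sub_le_self _ x.nonneg⟩

instance [Fact (0 ≤ u)] : Zero (UnitInterval G u) := ⟨⟨0, le_rfl, Fact.out⟩⟩

theorem val_add (x y : UnitInterval G u) : (x + y).val = min u (x.val + y.val) := rfl

theorem val_compl (x : UnitInterval G u) : xᶜ.val = u - x.val := rfl

omit [IsOrderedAddMonoid G] in
theorem val_zero [Fact (0 ≤ u)] : (0 : UnitInterval G u).val = 0 := rfl

theorem val_join (x y : UnitInterval G u) : ((xᶜ + y)ᶜ + y).val = max x.val y.val := by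
  simp only [val_add, val_compl]
  rcases le_total x.val y.val with h | h
  · have h1 : u ≤ u - x.val + y.val := by rw [sub_add]; exact le_sub_self_iff u |>.2 (sub_nonpos.2 h)
    rw [min_eq_left h1, sub_self, zero_add, min_eq_right y.le, max_eq_right h]
  · have h1 : u - x.val + y.val ≤ u := by rw [sub_add]; exact sub_le_self _ (sub_nonneg.2 h)
    rw [min_eq_right h1, max_eq_left h, sub_add, add_sub_cancel_right, sub_sub_cancel,
      min_eq_right x.le]

protected theorem add_comm (x y : UnitInterval G u) : x + y = y + x := by
  ext
  rw [val_add, val_add, add_comm]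

theorem val_add_add (x y z : UnitInterval G u) :
    (x + y + z).val = min u (x.val + y.val + z.val) := by
  rw [val_add, val_add, ← min_add_add_right, ← min_assoc,
    min_eq_left (le_add_of_nonneg_right z.nonneg)]

protected theorem zero_add [Fact (0 ≤ u)] (x : UnitInterval G u) : 0 + x = x := by
  ext
  rw [val_add, val_zero, zero_add, min_eq_right x.le]

/-- The totally ordered MV-algebra on the unit interval of a totally ordered abelian group. -/
instance [Fact (0 ≤ u)] : MVChain (UnitInterval G u) where
  add_assoc x y z := by
    rw [UnitInterval.add_comm x (y + z)]
    ext
    rw [val_add_add, val_add_add, add_assoc, add_comm x.val]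
  zero_add := UnitInterval.zero_add
  add_zero x := by rw [UnitInterval.add_comm, UnitInterval.zero_add]
  add_comm := UnitInterval.add_comm
  nsmul := nsmulRec
  compl_compl' x := by
    ext
    simp only [val_compl, sub_sub_cancel]
  add_one' x := by
    ext
    rw [val_add, val_compl, val_zero, sub_zero, min_eq_left (le_add_of_nonneg_left x.nonneg)]
  sup_comm' x y := by
    ext
    rw [val_join, val_join, max_comm]
  le_total' x y := by
    have h : ∀ x y : UnitInterval G u, x.val ≤ y.val → xᶜ + y = 0ᶜ := by
      intro x y h
      ext
      rw [val_add, val_compl, val_compl, val_zero, sub_zero, sub_add]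
      exact min_eq_left (le_sub_self_iff u |>.2 (sub_nonpos.2 h))
    exact (le_total x.val y.val).imp (h x y) (h y x)

end UnitInterval

end MVAlgebra

/-! ### Amalgamation of totally ordered abelian groups -/

section amalgamation

/-- A submonoid of an abelian group that is maximal among those disjoint from a subsemigroup is
total; such submonoids exist. -/
theorem AddSubmonoid.exists_total_of_disjoint {M : Type*} [AddCommGroup M] (P₀ : AddSubmonoid M)
    (N : Set M) (hN : ∀ x ∈ N, ∀ y ∈ N, x + y ∈ N) (hd : ∀ x ∈ P₀, x ∉ N) :
    ∃ P : AddSubmonoid M, P₀ ≤ P ∧ (∀ x ∈ P, x ∉ N) ∧ ∀ x, x ∈ P ∨ -x ∈ P := by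
  obtain ⟨P, hP₀, hP⟩ := zorn_le_nonempty₀ {P : AddSubmonoid M | ∀ x ∈ P, x ∉ N}
    (fun c hc hchain P hPc => ⟨sSup c, fun x hx => by
      obtain ⟨Q, hQ, hxQ⟩ := (AddSubmonoid.mem_sSup_of_directedOn ⟨P, hPc⟩ hchain.directedOn).1 hx
      exact hc hQ x hxQ, fun Q hQ => le_sSup hQ⟩) P₀ hd
  refine ⟨P, hP₀, hP.prop, fun x => ?_⟩
  -- By maximality, adjoining x must produce an element of N; n = 0 is excluded because P itself
  -- avoids N.
  have key : ∀ x, x ∉ P → ∃ p ∈ P, ∃ n : ℕ, p + n • x ∈ N ∧ n ≠ 0 := by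
    intro x hx
    by_contra! h
    refine hx (hP.le_of_ge (y := P ⊔ AddSubmonoid.multiples x) ?_ le_sup_left
      ((le_sup_right : _ ≤ P ⊔ AddSubmonoid.multiples x) (AddSubmonoid.mem_multiples x)))
    intro y hy hyN
    obtain ⟨p, hp, z, ⟨n, rfl⟩, rfl⟩ := AddSubmonoid.mem_sup.1 hy
    have hn := h p hp n hyN
    simp only [hn, zero_smul, add_zero] at hyN
    exact hP.prop p hp hyN
  have smul : ∀ n : ℕ, n ≠ 0 → ∀ x ∈ N, n • x ∈ N := by
    intro n hn x hx
    induction n, Nat.one_le_iff_ne_zero.2 hn using Nat.le_induction with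
    | base => rwa [one_smul]
    | succ n hn' ih => rw [succ_nsmul]; exact hN _ (ih (by omega)) _ hx
  by_contra! h
  obtain ⟨p, hp, n, hpn, hn⟩ := key x h.1
  obtain ⟨q, hq, m, hqm, hm⟩ := key (-x) h.2
  -- These multiples cancel x, leaving an element of P that also lies in N.
  have h1 : m • (p + n • x) + n • (q + m • -x) = m • p + n • q := by
    simp only [smul_add, smul_neg, smul_smul, mul_comm m n]
    abel
  exact hP.prop _ (P.add_mem (P.nsmul_mem hp m) (P.nsmul_mem hq n))
    (h1 ▸ hN _ (smul m hm _ hpn) _ (smul n hn _ hqm))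

/-- The quotient of a group by the units of a total submonoid is totally ordered. -/
theorem AddSubmonoid.exists_orderedGroup {M : Type u} [AddCommGroup M] (P : AddSubmonoid M)
    (hP : ∀ x, x ∈ P ∨ -x ∈ P) :
    ∃ (V : Type u) (_ : AddCommGroup V) (_ : LinearOrder V) (_ : IsOrderedAddMonoid V)
      (π : M →+ V), ∀ x, 0 ≤ π x ↔ x ∈ P := by
  classical
  let H : AddSubgroup M :=
    { carrier := {x | x ∈ P ∧ -x ∈ P}
      zero_mem' := ⟨P.zero_mem, by rw [neg_zero]; exact P.zero_mem⟩
      add_mem' := fun {x y} hx hy => ⟨P.add_mem hx.1 hy.1, by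
        rw [neg_add]; exact P.add_mem hx.2 hy.2⟩
      neg_mem' := fun {x} hx => ⟨hx.2, by rw [neg_neg]; exact hx.1⟩ }
  have hH : ∀ x, x ∈ H ↔ x ∈ P ∧ -x ∈ P := fun x => Iff.rfl
  let K : AddSubmonoid (M ⧸ H) := P.map (QuotientAddGroup.mk' H)
  have hK : ∀ x : M, (x : M ⧸ H) ∈ K ↔ x ∈ P := by
    intro x
    refine ⟨?_, fun hx => ⟨x, hx, rfl⟩⟩
    rintro ⟨y, hy, hyx⟩
    have h1 : -y + x ∈ H := QuotientAddGroup.eq.1 hyx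
    have h2 := P.add_mem hy ((hH _).1 h1).1
    rwa [add_neg_cancel_left] at h2
  let C : AddGroupCone (M ⧸ H) :=
    { K with
      eq_zero_of_mem_of_neg_mem' := by
        intro a
        induction a using QuotientAddGroup.induction_on with
        | H x =>
          intro h1 h2
          rw [QuotientAddGroup.eq_zero_iff, hH]
          exact ⟨(hK x).1 h1, (hK (-x)).1 h2⟩ }
  have hC : ∀ x : M, (x : M ⧸ H) ∈ C ↔ x ∈ P := hK
  have : HasMemOrNegMem C := ⟨fun a => by
    induction a using QuotientAddGroup.induction_on with
    | H x => exact (hP x).imp (hC x).2 (hC (-x)).2⟩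
  let _ : LinearOrder (M ⧸ H) := LinearOrder.mkOfAddGroupCone C
  refine ⟨M ⧸ H, inferInstance, inferInstance, IsOrderedAddMonoid.mkOfCone C,
    QuotientAddGroup.mk' H, fun x => ?_⟩
  rw [← hC x]
  show (x : M ⧸ H) - 0 ∈ C ↔ _
  rw [sub_zero]

/-- Totally ordered abelian groups have the amalgamation property, for finite families. -/
theorem exists_orderedGroup_amalgam {ι : Type} [Fintype ι] [DecidableEq ι] {G : ι → Type u}
    [∀ i, AddCommGroup (G i)] [∀ i, LinearOrder (G i)] [∀ i, IsOrderedAddMonoid (G i)]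
    {C : Type*} [AddCommGroup C] [LinearOrder C] [IsOrderedAddMonoid C] (f : ∀ i, C →+ G i)
    (hf : ∀ i, StrictMono (f i)) :
    ∃ (V : Type u) (_ : AddCommGroup V) (_ : LinearOrder V) (_ : IsOrderedAddMonoid V)
      (e : ∀ i, G i →+ V), (∀ i, StrictMono (e i)) ∧ ∀ i j c, e i (f i c) = e j (f j c) := by
  -- The images of tuples from C with sum zero are the relations that the amalgam must kill. `P₀`
  -- consists of the tuples above a relation, and so must become nonnegative.
  let P₀ : AddSubmonoid (∀ i, G i) :=
    { carrier := {g | ∃ c : ι → C, ∑ i, c i = 0 ∧ ∀ i, f i (c i) ≤ g i}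
      zero_mem' := ⟨0, by simp, by simp⟩
      add_mem' := by
        rintro g h ⟨c, hc, hcg⟩ ⟨d, hd, hdh⟩
        refine ⟨c + d, by simp [Finset.sum_add_distrib, hc, hd], fun i => ?_⟩
        rw [Pi.add_apply, map_add]
        exact add_le_add (hcg i) (hdh i) }
  have hmem : ∀ g, g ∈ P₀ ↔ ∃ c : ι → C, ∑ i, c i = 0 ∧ ∀ i, f i (c i) ≤ g i := fun _ => Iff.rfl
  -- Tuples below a relation and strictly so in some coordinate: these must become negative. A tuple
  -- in both sets would give c ≤ d with one strict inequality, although both sums are zero.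
  let N : Set (∀ i, G i) :=
    {g | ∃ c : ι → C, ∑ i, c i = 0 ∧ (∀ i, g i ≤ f i (c i)) ∧ ∃ i, g i < f i (c i)}
  obtain ⟨P, hP₀, hPN, hP⟩ := P₀.exists_total_of_disjoint N (by
    rintro g ⟨c, hc, hcg, i, hi⟩ h ⟨d, hd, hdh, -⟩
    refine ⟨c + d, by simp [Finset.sum_add_distrib, hc, hd], fun i => ?_, i, ?_⟩
    · rw [Pi.add_apply, Pi.add_apply, map_add]
      exact add_le_add (hcg i) (hdh i)
    · rw [Pi.add_apply, Pi.add_apply, map_add]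
      exact add_lt_add_of_lt_of_le hi (hdh i)) (by
    rintro g ⟨c, hc, hcg⟩ ⟨d, hd, hdg, i, hi⟩
    have h1 : ∑ i, c i < ∑ i, d i := Finset.sum_lt_sum
      (fun j _ => (hf j).le_iff_le.1 ((hcg j).trans (hdg j)))
      ⟨i, Finset.mem_univ i, (hf i).lt_iff_lt.1 ((hcg i).trans_lt hi)⟩
    rw [hc, hd] at h1
    exact lt_irrefl _ h1)
  obtain ⟨V, i₁, i₂, i₃, π, hπ⟩ := P.exists_orderedGroup hP
  refine ⟨V, i₁, i₂, i₃, fun i => π.comp (AddMonoidHom.single G i), fun i x y hxy => ?_,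
    fun i j c => ?_⟩
  · have h1 : ¬ 0 ≤ π (Pi.single i (x - y)) := by
      rw [hπ]
      refine fun h => hPN _ h ⟨0, by simp, fun j => ?_, i, ?_⟩
      · rw [Pi.zero_apply, map_zero]
        by_cases hj : j = i
        · subst hj; simpa [sub_nonpos] using hxy.le
        · rw [Pi.single_eq_of_ne hj]
      · simpa using hxy
    rw [not_le, Pi.single_sub, map_sub, sub_neg] at h1
    exact h1
  · have h1 : ∀ i j, 0 ≤ π (Pi.single i (f i c) - Pi.single j (f j c)) := by
      intro i j
      rw [hπ]
      -- The difference of the two copies of c is itself a relation; exchanging i and j gives both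
      -- inequalities.
      refine hP₀ ((hmem _).2 ⟨Pi.single i c - Pi.single j c, by simp, fun l => ?_⟩)
      rw [Pi.sub_apply, Pi.sub_apply, map_sub]
      have h2 : ∀ i, f l ((Pi.single i c : ι → C) l) = (Pi.single i (f i c) : ∀ i, G i) l := by
        intro i
        by_cases hl : l = i
        · subst hl; simp
        · rw [Pi.single_eq_of_ne hl, Pi.single_eq_of_ne hl, map_zero]
      rw [h2, h2]
    have h2 := h1 i j
    have h3 := h1 j i
    rw [map_sub, sub_nonneg] at h2 h3
    exact le_antisymm h3 h2

end amalgamation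

/-! ### Amalgamation of totally ordered MV-algebras -/

namespace MVAlgebra

/-- Totally ordered MV-algebras have the amalgamation property, for finite families. -/
theorem exists_mvChain_amalgam {ι : Type} [Fintype ι] [DecidableEq ι] [Nonempty ι]
    {B : ι → Type u} [∀ i, MVChain (B i)] [∀ i, Nontrivial (B i)] {C : Type*} [MVChain C]
    [Nontrivial C] (f : ∀ i, Embedding C (B i)) :
    ∃ (V : Type u) (_ : MVChain V) (e : ∀ i, Embedding (B i) V),
      ∀ i j c, (e i).toFun ((f i).toFun c) = (e j).toFun ((f j).toFun c) := by
  obtain ⟨W, _, _, _, w, hw, hwf⟩ := exists_orderedGroup_amalgam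
    (fun i => ChangGroup.map (f i)) fun i => ChangGroup.map_strictMono (f i)
  obtain ⟨i₀⟩ := ‹Nonempty ι›
  let one : W := w i₀ (ChangGroup.unit (B i₀))
  -- All strong units come from the unit of C, so they are identified and one interval serves every
  -- i.
  have hone : ∀ i, w i (ChangGroup.unit (B i)) = one := by
    intro i
    have h : w i (ChangGroup.map (f i) (ChangGroup.of 0ᶜ)) =
        w i₀ (ChangGroup.map (f i₀) (ChangGroup.of 0ᶜ)) := hwf i i₀ _
    rwa [ChangGroup.map_of, ChangGroup.map_of, Embedding.map_one, Embedding.map_one,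
      ChangGroup.of_one, ChangGroup.of_one] at h
  have hnonneg : ∀ i (b : B i), 0 ≤ w i (ChangGroup.of b) := fun i b => by
    rw [← map_zero (w i)]
    exact (hw i).monotone (ChangGroup.of_nonneg b)
  have : Fact (0 ≤ one) := ⟨by
    rw [← hone i₀, ← ChangGroup.of_one]
    exact hnonneg _ _⟩
  refine ⟨UnitInterval W one, inferInstance, fun i =>
    { toFun := fun b => ⟨w i (ChangGroup.of b), hnonneg i b, by
        rw [← hone i]
        exact (hw i).monotone (ChangGroup.of_le_unit b)⟩
      injective := fun a b h => ChangGroup.of_injective ((hw i).injective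
        (congrArg UnitInterval.val h))
      map_zero := ?_
      map_add := fun a b => ?_
      map_compl := fun a => ?_ }, fun i j c => ?_⟩
  · ext
    rw [UnitInterval.val_zero]
    simp only [ChangGroup.of_zero, map_zero]
  · ext
    rw [UnitInterval.val_add]
    simp only [ChangGroup.of_add, (hw i).monotone.map_min, hone, map_add]
  · ext
    rw [UnitInterval.val_compl]
    simp only [ChangGroup.of_compl, map_sub, hone]
  · ext
    have h := hwf i j (ChangGroup.of c)
    simpa only [ChangGroup.map_of] using h

/-! ### Quotients of MV-algebras -/

section quotient

variable {A : Type*} [MVAlgebra A]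

/-- The congruence generated by `e ~ 0` for `e` in a submonoid. -/
def addCon (I : AddSubmonoid A) : AddCon A where
  r x y := ∃ e ∈ I, x ≤ y + e ∧ y ≤ x + e
  iseqv :=
    { refl := fun x => ⟨0, I.zero_mem, by rw [add_zero], by rw [add_zero]⟩
      symm := fun ⟨e, he, h1, h2⟩ => ⟨e, he, h2, h1⟩
      trans := fun {x y z} ⟨e, he, h1, h2⟩ ⟨d, hd, h3, h4⟩ => ⟨d + e, I.add_mem hd he, by
        rw [← add_assoc]; exact h1.trans (add_le_add_left h3 e), by
        rw [add_comm d, ← add_assoc]; exact h4.trans (add_le_add_left h2 d)⟩ }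
  add' := fun {x y z w} ⟨e, he, h1, h2⟩ ⟨d, hd, h3, h4⟩ => ⟨e + d, I.add_mem he hd, by
    rw [add_add_add_comm]; exact add_le_add h1 h3, by
    rw [add_add_add_comm]; exact add_le_add h2 h4⟩

theorem addCon_apply {I : AddSubmonoid A} {x y : A} :
    addCon I x y ↔ ∃ e ∈ I, x ≤ y + e ∧ y ≤ x + e := Iff.rfl

theorem addCon_compl {I : AddSubmonoid A} {x y : A} (h : addCon I x y) : addCon I xᶜ yᶜ := by
  obtain ⟨e, he, h1, h2⟩ := addCon_apply.1 h
  exact addCon_apply.2 ⟨e, he, compl_le_add_iff.2 h2, compl_le_add_iff.2 h1⟩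

instance (I : AddSubmonoid A) : MVAlgebra (addCon I).Quotient where
  compl := Quotient.map compl fun _ _ h => addCon_compl h
  compl_compl' x := by
    induction x using AddCon.induction_on with
    | H x => exact congrArg (AddCon.toQuotient (c := addCon I)) (compl_compl' x)
  add_one' x := by
    induction x using AddCon.induction_on with
    | H x => exact congrArg (AddCon.toQuotient (c := addCon I)) (add_one' x)
  sup_comm' x y := by
    induction x using AddCon.induction_on with
    | H x =>
      induction y using AddCon.induction_on with
      | H y => exact congrArg (AddCon.toQuotient (c := addCon I)) (sup_comm' x y)

/-- The quotient map. -/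
def toQuot (I : AddSubmonoid A) (x : A) : (addCon I).Quotient := x

theorem toQuot_surjective (I : AddSubmonoid A) : Function.Surjective (toQuot I) :=
  fun x => Quotient.exists_rep x

theorem toQuot_zero (I : AddSubmonoid A) : toQuot I 0 = 0 := rfl
theorem toQuot_add (I : AddSubmonoid A) (x y : A) : toQuot I (x + y) = toQuot I x + toQuot I y := rfl
theorem toQuot_compl (I : AddSubmonoid A) (x : A) : toQuot I xᶜ = (toQuot I x)ᶜ := rfl

theorem toQuot_eq_iff {I : AddSubmonoid A} {x y : A} :
    toQuot I x = toQuot I y ↔ ∃ e ∈ I, x ≤ y + e ∧ y ≤ x + e := AddCon.eq _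

theorem toQuot_le_iff {I : AddSubmonoid A} {x y : A} :
    toQuot I x ≤ toQuot I y ↔ ∃ e ∈ I, x ≤ y + e := by
  rw [le_iff, ← toQuot_compl, ← toQuot_add, ← toQuot_zero, ← toQuot_compl, toQuot_eq_iff]
  refine exists_congr fun e => and_congr_right fun _ => ?_
  rw [one_le_iff, add_assoc, ← le_iff]
  exact and_iff_right ((le_one _).trans le_self_add)

/-- The quotient by a prime ideal is totally ordered. -/
@[reducible]
def quotientChain (I : AddSubmonoid A) (hI : ∀ x y, x - y ∈ I ∨ y - x ∈ I) :
    MVChain (addCon I).Quotient where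
  le_total' x y := by
    obtain ⟨x, rfl⟩ := toQuot_surjective I x
    obtain ⟨y, rfl⟩ := toQuot_surjective I y
    exact (hI x y).imp (fun h => toQuot_le_iff.2 ⟨_, h, le_add_tsub⟩)
      fun h => toQuot_le_iff.2 ⟨_, h, le_add_tsub⟩

end quotient

end MVAlgebra

/-! ### Constants and finite subdirect irreducibility -/

namespace MonadicMVAlgebra
open MVAlgebra

variable {A : Type*} [MonadicMVAlgebra A]

theorem imp_eq_one_iff {x y : A} : imp x y = 0ᶜ ↔ x ≤ y := Iff.rfl

theorem all_le (x : A) : all x ≤ x := m1 x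

theorem all_one : all (0ᶜ : A) = 0ᶜ := by
  have h := m3 (0 : A) 0
  rw [imp_eq_one_iff.2 (all_le _), imp_eq_one_iff.2 le_rfl] at h
  exact h

theorem all_zero : all (0 : A) = 0 := le_antisymm (all_le 0) zero_le

theorem one_imp (x : A) : imp 0ᶜ x = x := by rw [imp, compl_compl_eq, zero_add]

theorem imp_zero (x : A) : imp x 0 = xᶜ := add_zero _

theorem ex_eq (x : A) : ex x = (all xᶜ)ᶜ := by
  have h := m2 x 0
  rw [all_zero, imp_zero, imp_zero] at h
  rw [h, compl_compl_eq]

theorem ex_one : ex (0ᶜ : A) = 0ᶜ := by rw [ex_eq, compl_compl_eq, all_zero]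

theorem all_all (x : A) : all (all x) = all x := by
  have h := m2 0ᶜ x
  rwa [ex_one, one_imp] at h

theorem all_mono {x y : A} (h : x ≤ y) : all x ≤ all y := by
  have h1 := m3 x y
  rw [imp_eq_one_iff.2 ((all_le x).trans h), all_one] at h1
  exact h1.symm

/-- The elements fixed by `∀`. -/
def IsConst (x : A) : Prop := all x = x

theorem isConst_all (x : A) : IsConst (all x) := all_all x

theorem IsConst.zero : IsConst (0 : A) := all_zero

theorem IsConst.imp {x y : A} (hx : IsConst x) (hy : IsConst y) : IsConst (imp x y) := by
  have h := m3 x (all y)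
  rwa [all_all, hx, hy] at h

theorem IsConst.compl {x : A} (hx : IsConst x) : IsConst xᶜ := by
  rw [← imp_zero]; exact hx.imp .zero

theorem IsConst.add {x y : A} (hx : IsConst x) (hy : IsConst y) : IsConst (x + y) := by
  have h := hx.compl.imp hy
  rwa [MVAlgebra.imp, compl_compl_eq] at h

theorem IsConst.sub {x y : A} (hx : IsConst x) (hy : IsConst y) : IsConst (x - y) :=
  (hx.compl.add hy).compl

theorem IsConst.nsmul {x : A} (hx : IsConst x) (n : ℕ) : IsConst (n • x) := by
  induction n with
  | zero => rw [zero_nsmul]; exact .zero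
  | succ n ih => rw [succ_nsmul]; exact ih.add hx

theorem all_add_const (x : A) {c : A} (hc : IsConst c) : all (x + c) = all x + c := by
  have h := m3 cᶜ x
  rwa [hc.compl, MVAlgebra.imp, MVAlgebra.imp, compl_compl_eq, add_comm, add_comm c] at h

/-- The De Morgan dual of `m5`. It is what makes `∀ a = 0` pass to multiples of a. -/
theorem all_add_self (x : A) : all (x + x) = all x + all x := by
  have h := m5 xᶜ
  simp only [prod, ex_eq, compl_compl_eq] at h
  rwa [compl_inj'] at h

/-- Adding the constant ∀x back commutes with `∀` and returns ∀x; nothing overflows, so it cancels.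
-/
theorem all_sub_all (x : A) : all (x - all x) = 0 := by
  have h1 := all_add_const (x - all x) (isConst_all x)
  rw [tsub_add_cancel_of_le (all_le x)] at h1
  have h2 : all (x - all x) ≤ (all x)ᶜ := (all_le _).trans (sub_le_compl _ _)
  rw [← add_sub_cancel_of_le_compl h2, ← h1]
  exact le_antisymm (tsub_le_iff_right.2 (by rw [zero_add])) zero_le

/-- The congruence of a monadic MV-algebra generated by `c ~ 0`, for a constant `c`. -/
def constCongruence (c : A) (hc : IsConst c) : MonadicMVCongruence A :=
  have hall : ∀ x y : A, addCon (AddSubmonoid.multiples c) x y →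
      addCon (AddSubmonoid.multiples c) (all x) (all y) := by
    rintro x y ⟨_, ⟨n, rfl⟩, h1, h2⟩
    refine ⟨_, ⟨n, rfl⟩, ?_, ?_⟩
    · rw [← all_add_const _ (hc.nsmul n)]; exact all_mono h1
    · rw [← all_add_const _ (hc.nsmul n)]; exact all_mono h2
  { (addCon (AddSubmonoid.multiples c)).toSetoid with
    add' := (addCon (AddSubmonoid.multiples c)).add'
    compl' := addCon_compl
    ex' := fun {a b} h => by
      rw [ex_eq, ex_eq]
      exact addCon_compl (hall _ _ (addCon_compl h))
    all' := fun h => hall _ _ h }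

theorem constCongruence_r {c : A} {hc : IsConst c} {x y : A} :
    (constCongruence c hc).r x y ↔ ∃ n : ℕ, x ≤ y + n • c ∧ y ≤ x + n • c := by
  refine ⟨?_, ?_⟩
  · rintro ⟨_, ⟨n, rfl⟩, h⟩
    exact ⟨n, h⟩
  · rintro ⟨n, h⟩
    exact ⟨_, ⟨n, rfl⟩, h⟩

theorem eq_zero_of_constCongruence_trivial {c : A} {hc : IsConst c}
    (h : ∀ x y, (constCongruence c hc).r x y → x = y) : c = 0 :=
  h c 0 (constCongruence_r.2 ⟨1, by rw [one_nsmul, zero_add], zero_le⟩)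

theorem IsFSI.isConst_total (h : IsFSI A) {c d : A} (hc : IsConst c) (hd : IsConst d) :
    c ≤ d ∨ d ≤ c := by
  rw [← tsub_nonpos, ← tsub_nonpos (a := d)]
  refine (h (constCongruence _ (hc.sub hd)) (constCongruence _ (hd.sub hc)) ?_).imp
    (fun h => (eq_zero_of_constCongruence_trivial h).le)
    fun h => (eq_zero_of_constCongruence_trivial h).le
  rintro a b ⟨h1, h2⟩
  obtain ⟨m, hm, hm'⟩ := constCongruence_r.1 h1
  obtain ⟨n, hn, hn'⟩ := constCongruence_r.1 h2
  -- The two congruences bound a by b plus multiples of disjoint elements; the meet of the two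
  -- bounds is b itself.
  have h3 := nsmul_inf_nsmul_eq_zero (sub_inf_sub_eq_zero c d) m n
  refine le_antisymm ?_ ?_
  · have h4 := le_inf hm hn
    rwa [← add_inf_eq, h3, add_zero] at h4
  · have h4 := le_inf hm' hn'
    rwa [← add_inf_eq, h3, add_zero] at h4

end MonadicMVAlgebra

/-! ### Generated ideals and separation of prime ideals -/

namespace MVAlgebra

variable {A : Type*} [MVAlgebra A]

/-- The ideal generated by an ideal and an element. -/
def adjoin (I : AddSubmonoid A) (x : A) : AddSubmonoid A where
  carrier := {z | ∃ f ∈ I, ∃ n : ℕ, z ≤ f + n • x}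
  zero_mem' := ⟨0, I.zero_mem, 0, zero_le⟩
  add_mem' := by
    rintro y z ⟨f, hf, m, hm⟩ ⟨g, hg, n, hn⟩
    refine ⟨f + g, I.add_mem hf hg, m + n, ?_⟩
    rw [add_nsmul, add_add_add_comm]
    exact add_le_add hm hn

theorem isLowerSet_adjoin (I : AddSubmonoid A) (x : A) : IsLowerSet (adjoin I x : Set A) := by
  rintro y z hzy ⟨f, hf, n, h⟩
  exact ⟨f, hf, n, hzy.trans h⟩

theorem self_mem_adjoin (I : AddSubmonoid A) (x : A) : x ∈ adjoin I x :=
  ⟨0, I.zero_mem, 1, by rw [one_nsmul, zero_add]⟩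

theorem le_adjoin (I : AddSubmonoid A) (x : A) : I ≤ adjoin I x := fun y hy =>
  ⟨y, hy, 0, by rw [zero_nsmul, add_zero]⟩

theorem le_inf_add_sub (x y : A) : x ≤ x ⊓ y + (x - y) := by
  rw [add_comm, add_inf_eq]
  exact le_inf le_add_self (by rw [add_comm]; exact le_add_tsub)

theorem mem_or_mem_of_inf_mem {I : AddSubmonoid A} (hI : IsLowerSet (I : Set A))
    (hp : ∀ x y, x - y ∈ I ∨ y - x ∈ I) {x y : A} (h : x ⊓ y ∈ I) : x ∈ I ∨ y ∈ I :=
  (hp x y).imp (fun h1 => hI (le_inf_add_sub x y) (I.add_mem h h1))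
    fun h1 => hI (le_inf_add_sub y x) (I.add_mem (inf_comm x y ▸ h) h1)

/-- Pairwise incomparable prime ideals are separated by a family of pairwise disjoint elements. -/
theorem exists_disjoint_separating {ι : Type*} [Fintype ι] {I : ι → AddSubmonoid A}
    (hlow : ∀ i, IsLowerSet (I i : Set A)) (hprime : ∀ i x y, x - y ∈ I i ∨ y - x ∈ I i)
    (hproper : ∀ i, 0ᶜ ∉ I i) (hne : ∀ i j, i ≠ j → ¬ I i ≤ I j) :
    ∃ y : ι → A, (∀ i, y i ∉ I i) ∧ ∀ i j, i ≠ j → y i ⊓ y j = 0 := by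
  classical
  have h1 : ∀ i j, ∃ a, i ≠ j → a ∈ I i ∧ a ∉ I j := by
    intro i j
    by_cases h : i = j
    · exact ⟨0, fun h1 => absurd h h1⟩
    · obtain ⟨a, ha⟩ := SetLike.not_le_iff_exists.1 (hne i j h)
      exact ⟨a, fun _ => ha⟩
  choose a ha using h1
  -- Since `a j i` lies outside I i and `a i j` inside, each difference is outside I i, and
  -- primeness keeps their meet outside. For i ≠ j the two elements lie below opposite differences,
  -- which are disjoint.
  refine ⟨fun i => (Finset.univ.filter (i ≠ ·)).inf fun j => a j i - a i j, fun i => ?_,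
    fun i j hij => ?_⟩
  · refine Finset.inf_induction (p := fun z => z ∉ I i) (hproper i) ?_ fun j hj h => ?_
    · intro x hx y hy h
      exact (mem_or_mem_of_inf_mem (hlow i) (hprime i) h).elim hx hy
    · have hij := (Finset.mem_filter.1 hj).2
      exact (ha j i hij.symm).2 (hlow i le_add_tsub ((I i).add_mem (ha i j hij).1 h))
  · refine le_antisymm ?_ zero_le
    rw [← sub_inf_sub_eq_zero (a j i) (a i j)]
    exact inf_le_inf (Finset.inf_le (by simpa using hij)) (Finset.inf_le (by simpa using hij.symm))

end MVAlgebra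

/-- X has at most k elements, so it injects into `Fin k`, and a left inverse lists X with possible
repetitions. -/
theorem exists_surjective_of_forall_not_injective {X : Type*} [Nonempty X] {k : ℕ}
    (h : ∀ f : Fin (k + 1) → X, ¬ Function.Injective f) :
    ∃ g : Fin k → X, Function.Surjective g := by
  have hfin : Finite X := by
    by_contra hX
    rw [not_finite_iff_infinite] at hX
    exact h _ ((Infinite.natEmbedding X).injective.comp Fin.val_injective)
  have hcard : Nat.card X ≤ k := by
    by_contra! hX
    exact h _ ((Finite.equivFin X).symm.injective.comp (Fin.castLE_injective hX))
  exact ⟨_, Function.invFun_surjective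
    ((Fin.castLE_injective hcard).comp (Finite.equivFin X).injective)⟩

namespace MonadicMVAlgebra
open MVAlgebra

/-! ### Maximal null ideals -/

section maximal

variable {A : Type*} [MonadicMVAlgebra A]

/-- Ideals all of whose elements satisfy `∀ a = 0`. -/
structure IsNullIdeal (I : AddSubmonoid A) : Prop where
  lower : IsLowerSet (I : Set A)
  null : ∀ a ∈ I, all a = 0

theorem IsNullIdeal.eq_zero {I : AddSubmonoid A} (hI : IsNullIdeal I) {c : A} (hc : IsConst c)
    (h : c ∈ I) : c = 0 := by
  rw [← hI.null c h]; exact hc.symm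

theorem IsNullIdeal.exists_le_maximal {I : AddSubmonoid A} (hI : IsNullIdeal I) :
    ∃ M, I ≤ M ∧ Maximal IsNullIdeal M := by
  refine zorn_le_nonempty₀ {I : AddSubmonoid A | IsNullIdeal I} (fun c hc hchain P hP =>
    ⟨sSup c, ?_, fun Q hQ => le_sSup hQ⟩) I hI
  have hmem : ∀ x, x ∈ sSup c ↔ ∃ Q ∈ c, x ∈ Q := fun x =>
    AddSubmonoid.mem_sSup_of_directedOn ⟨P, hP⟩ hchain.directedOn
  refine ⟨fun x y hyx hx => ?_, fun x hx => ?_⟩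
  · obtain ⟨Q, hQ, hxQ⟩ := (hmem x).1 hx
    have hQ' : IsNullIdeal Q := hc hQ
    exact (hmem y).2 ⟨Q, hQ, hQ'.lower hyx hxQ⟩
  · obtain ⟨Q, hQ, hxQ⟩ := (hmem x).1 hx
    have hQ' : IsNullIdeal Q := hc hQ
    exact hQ'.null x hxQ

/-- Doubling handles powers of two, and n • a lies below 2 ^ n • a. -/
theorem all_nsmul_eq_zero {a : A} (ha : all a = 0) (n : ℕ) : all (n • a) = 0 := by
  have h : ∀ n : ℕ, all (2 ^ n • a) = 0 := by
    intro n
    induction n with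
    | zero => rwa [pow_zero, one_nsmul]
    | succ n ih => rw [pow_succ, mul_two, add_nsmul, all_add_self, ih, add_zero]
  refine le_antisymm ?_ zero_le
  rw [← h n]
  exact all_mono (nsmul_le_nsmul_left zero_le Nat.lt_two_pow_self.le)

theorem exists_maximal_mem {a : A} (ha : all a = 0) :
    ∃ M : AddSubmonoid A, Maximal IsNullIdeal M ∧ a ∈ M := by
  have h : IsNullIdeal (adjoin ⊥ a) := by
    refine ⟨isLowerSet_adjoin _ _, ?_⟩
    rintro z ⟨f, hf, n, hn⟩
    rw [AddSubmonoid.mem_bot.1 hf, zero_add] at hn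
    refine le_antisymm ?_ zero_le
    rw [← all_nsmul_eq_zero ha n]
    exact all_mono hn
  obtain ⟨M, hM, hmax⟩ := h.exists_le_maximal
  exact ⟨M, hmax, hM (self_mem_adjoin _ _)⟩

theorem exists_all_ne_zero {M : AddSubmonoid A} (hM : Maximal IsNullIdeal M) {x : A} (hx : x ∉ M) :
    ∃ f ∈ M, ∃ n : ℕ, all (f + n • x) ≠ 0 := by
  by_contra! h
  refine hx (hM.le_of_ge (y := adjoin M x) ⟨isLowerSet_adjoin _ _, ?_⟩ (le_adjoin _ _)
    (self_mem_adjoin _ _))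
  rintro z ⟨f, hf, n, hn⟩
  refine le_antisymm ?_ zero_le
  rw [← h f hf n]
  exact all_mono hn

/-- If both differences were outside M, adjoining either would produce a nonzero constant. The
smaller of the two constants lies below both bounds; as multiples of the differences are disjoint,
it lies below f + g, hence in M, and must vanish. -/
theorem IsFSI.maximal_prime (h : IsFSI A) {M : AddSubmonoid A} (hM : Maximal IsNullIdeal M)
    (x y : A) : x - y ∈ M ∨ y - x ∈ M := by
  by_contra! hxy
  obtain ⟨f, hf, m, hm⟩ := exists_all_ne_zero hM hxy.1
  obtain ⟨g, hg, n, hn⟩ := exists_all_ne_zero hM hxy.2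
  have key : ∀ c : A, IsConst c → c ≤ f + m • (x - y) → c ≤ g + n • (y - x) → c = 0 := by
    intro c hc h1 h2
    have h3 : c ≤ (f + g) + (m • (x - y)) ⊓ (n • (y - x)) := by
      rw [add_inf_eq, add_right_comm, add_assoc f g]
      exact le_inf (h1.trans le_self_add) (h2.trans le_add_self)
    rw [nsmul_inf_nsmul_eq_zero (sub_inf_sub_eq_zero x y), add_zero] at h3
    exact hM.prop.eq_zero hc (hM.prop.lower h3 (M.add_mem hf hg))
  rcases h.isConst_total (isConst_all (f + m • (x - y))) (isConst_all (g + n • (y - x))) with h1 | h1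
  · exact hm (key _ (isConst_all _) (all_le _) (h1.trans (all_le _)))
  · exact hn (key _ (isConst_all _) (h1.trans (all_le _)) (all_le _))

/-- Distinct maximal null ideals are incomparable primes, so pairwise disjoint y i exist with y i
outside the i-th. At the complements of the y i the premise of the width identity is 1 while its
conclusion is not. -/
theorem IsFSI.not_injective_maximal (h : IsFSI A) (h01 : (0 : A) ≠ 0ᶜ) {k : ℕ}
    (hW : SatisfiesW A k) (M : Fin (k + 1) → {M : AddSubmonoid A // Maximal IsNullIdeal M}) :
    ¬ Function.Injective M := by
  intro hinj
  obtain ⟨y, hy, hdisj⟩ := exists_disjoint_separating (I := fun i => (M i).1)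
    (fun i => (M i).2.prop.lower) (fun i => h.maximal_prime (M i).2)
    (fun i hi => h01 ((M i).2.prop.eq_zero IsConst.zero.compl hi).symm)
    (fun i j hij hle => hij (hinj (Subtype.ext
      (le_antisymm hle ((M i).2.le_of_ge (M j).2.prop hle)))))
  have h1 := imp_eq_one_iff.1 (hW fun i => (y i)ᶜ)
  have h2 : (0ᶜ : A) ≤ (Finset.univ.filter fun p : Fin (k + 1) × Fin (k + 1) => p.1 < p.2).inf
      fun p => all ((y p.1)ᶜ ⊔ (y p.2)ᶜ) := by
    refine Finset.le_inf fun p hp => ?_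
    have h3 : (y p.1)ᶜ ⊔ (y p.2)ᶜ = (y p.1 ⊓ y p.2)ᶜ := (compl_compl_eq _).symm
    rw [h3, hdisj _ _ (Finset.mem_filter.1 hp).2.ne, all_one]
  -- A finite join of constants different from 1 is different from 1 because the constants form a
  -- chain.
  have h4 : IsConst (Finset.univ.sup fun i => all (y i)ᶜ) ∧
      (Finset.univ.sup fun i => all (y i)ᶜ) ≠ 0ᶜ := by
    refine Finset.sup_induction (p := fun c : A => IsConst c ∧ c ≠ 0ᶜ) ⟨IsConst.zero, h01⟩ ?_ ?_
    · intro c hc d hd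
      rcases h.isConst_total hc.1 hd.1 with h5 | h5
      · rwa [sup_eq_right.2 h5]
      · rwa [sup_eq_left.2 h5]
    · refine fun i _ => ⟨isConst_all _, fun h5 => hy i ?_⟩
      have h6 : (y i)ᶜ = 0ᶜ := one_le_iff.1 (h5 ▸ all_le _)
      rw [compl_inj'.1 h6]
      exact (M i).1.zero_mem
  exact h4.2 (one_le_iff.1 (h2.trans h1))

end maximal

/-- The subalgebra of elements fixed by `∀`. -/
def Constants (A : Type*) [MonadicMVAlgebra A] : Type _ := {x : A // IsConst x}

/-! ### The chain of constants and the embedding -/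

section constants

variable {A : Type*} [MonadicMVAlgebra A]

instance : Zero (Constants A) := ⟨⟨0, .zero⟩⟩

instance : Add (Constants A) := ⟨fun x y => ⟨x.1 + y.1, x.2.add y.2⟩⟩

instance : MVAlgebra (Constants A) where
  compl x := ⟨x.1ᶜ, x.2.compl⟩
  add_assoc x y z := Subtype.ext (add_assoc x.1 y.1 z.1)
  zero_add x := Subtype.ext (zero_add x.1)
  add_zero x := Subtype.ext (add_zero x.1)
  add_comm x y := Subtype.ext (add_comm x.1 y.1)
  nsmul := nsmulRec
  compl_compl' x := Subtype.ext (compl_compl' x.1)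
  add_one' x := Subtype.ext (add_one' x.1)
  sup_comm' x y := Subtype.ext (sup_comm' x.1 y.1)

/-- The constants of a finitely subdirectly irreducible algebra are totally ordered. -/
@[reducible]
def IsFSI.constantsChain (h : IsFSI A) : MVChain (Constants A) where
  le_total' x y := (h.isConst_total x.2 y.2).imp (fun h => Subtype.ext h) fun h => Subtype.ext h

/-- The constants embed in the quotient by a null ideal. -/
def IsNullIdeal.embedding {I : AddSubmonoid A} (hI : IsNullIdeal I) :
    Embedding (Constants A) (addCon I).Quotient where
  toFun c := toQuot I c.1
  injective c d h := by
    -- The difference c - d is a constant below an element of I, hence zero.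
    have key : ∀ c d : Constants A, toQuot I c.1 ≤ toQuot I d.1 → c.1 ≤ d.1 := by
      intro c d h
      obtain ⟨e, he, h1⟩ := toQuot_le_iff.1 h
      rw [← tsub_nonpos]
      exact (hI.eq_zero (c.2.sub d.2) (hI.lower (tsub_le_iff_left.2 h1) he)).le
    exact Subtype.ext (le_antisymm (key c d h.le) (key d c h.ge))
  map_zero := rfl
  map_add _ _ := rfl
  map_compl _ := rfl

end constants

/-- A finitely subdirectly irreducible algebra of width `k` embeds in a power `V^k`. -/
theorem IsFSI.exists_embedding_power {A : Type u} [MonadicMVAlgebra A] {k : ℕ} (hk : 1 ≤ k)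
    (hFSI : IsFSI A) (hwidth : HasWidth A k) :
    ∃ (V : Type u) (_ : MVChain V), Nonempty (MonadicMVEmbedding A (Fin k → V)) := by
  -- A trivial algebra satisfies every identity, including the one that fails here.
  have h01 : (0 : A) ≠ 0ᶜ := fun h => hwidth.2 fun x => by
    rw [eq_zero_of_one_eq_zero h.symm (imp _ _), ← h]
  obtain ⟨M₀, hM₀, -⟩ := exists_maximal_mem (all_zero (A := A))
  have : Nonempty {M : AddSubmonoid A // Maximal IsNullIdeal M} := ⟨⟨M₀, hM₀⟩⟩
  have : Nonempty (Fin k) := ⟨⟨0, hk⟩⟩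
  obtain ⟨M, hM⟩ := exists_surjective_of_forall_not_injective
    (hFSI.not_injective_maximal h01 hwidth.1)
  let _ : MVChain (Constants A) := hFSI.constantsChain
  let _ : ∀ i, MVChain (addCon (M i).1).Quotient := fun i =>
    quotientChain (M i).1 (hFSI.maximal_prime (M i).2)
  have : Nontrivial (Constants A) :=
    ⟨⟨0, .zero⟩, ⟨0ᶜ, IsConst.zero.compl⟩, fun h => h01 (congrArg Subtype.val h)⟩
  have : ∀ i, Nontrivial (addCon (M i).1).Quotient := fun i =>
    (M i).2.prop.embedding.injective.nontrivial
  obtain ⟨V, hV, e, he⟩ := exists_mvChain_amalgam fun i => (M i).2.prop.embedding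
  let α : A → Fin k → V := fun a i => (e i).toFun (toQuot (M i).1 a)
  have hconst : ∀ c : A, IsConst c → ∀ i j, α c i = α c j := fun c hc i j => he i j ⟨c, hc⟩
  have hadd : ∀ a b, α (a + b) = α a + α b := fun a b =>
    funext fun i => (e i).map_add (toQuot _ a) (toQuot _ b)
  have hcompl : ∀ a, α aᶜ = (α a)ᶜ := fun a => funext fun i => (e i).map_compl (toQuot _ a)
  have hzero : α 0 = 0 := funext fun i => (e i).map_zero
  have hmono : ∀ i, ∀ {a b : A}, toQuot (M i).1 a ≤ toQuot (M i).1 b → α a i ≤ α b i := by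
    intro i a b h
    rw [le_iff] at h ⊢
    show ((e i).toFun _)ᶜ + (e i).toFun _ = 0ᶜ
    rw [← (e i).map_compl, ← (e i).map_add, h, (e i).map_one]
  have hall : ∀ a, α (all a) = all (α a) := by
    intro a
    -- Modulo this ideal a and ∀a coincide, so its index j is where the tuple of a attains its
    -- minimum.
    obtain ⟨N, hN, haN⟩ := exists_maximal_mem (all_sub_all a)
    obtain ⟨j, hj⟩ := hM ⟨N, hN⟩
    have haj : a - all a ∈ (M j).1 := by rw [hj]; exact haN
    have hle : ∀ i, α (all a) i ≤ α a i := fun i =>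
      hmono i (toQuot_le_iff.2 ⟨0, AddSubmonoid.zero_mem _, by rw [add_zero]; exact all_le a⟩)
    have hj : α (all a) j = α a j :=
      le_antisymm (hle j) (hmono j (toQuot_le_iff.2 ⟨_, haj, le_add_tsub⟩))
    funext i
    refine ((hconst _ (isConst_all a) i j).trans hj).trans
      (forallInf_eq (f := α a) (x₀ := j) (fun l => ?_) i).symm
    rw [← hj, hconst _ (isConst_all a) j l]
    exact hle l
  have hone : ∀ a, α a = 0ᶜ → a = 0ᶜ := by
    intro a ha
    obtain ⟨i⟩ := ‹Nonempty (Fin k)›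
    -- A single coordinate suffices: both ∀a and 1 are constants, and constants embed in each
    -- quotient.
    have h1 : α (all a) i = α 0ᶜ i := by rw [hall, ha, all_one, hcompl, hzero]
    have h2 := (M i).2.prop.embedding.injective
      (a₁ := ⟨all a, isConst_all a⟩) (a₂ := ⟨0ᶜ, IsConst.zero.compl⟩) ((e i).injective h1)
    have h3 : all a = 0ᶜ := congrArg Subtype.val h2
    exact one_le_iff.1 (h3 ▸ all_le a)
  have hle : ∀ a b, α a = α b → a ≤ b := fun a b h => by
    rw [le_iff]
    refine hone _ ?_
    rw [hadd, hcompl, h]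
    exact compl_add_self _
  exact ⟨V, hV, ⟨{
    toFun := α
    injective' := fun a b h => le_antisymm (hle a b h) (hle b a h.symm)
    map_zero' := hzero
    map_add' := hadd
    map_compl' := hcompl
    map_ex' := fun a => by rw [ex_eq, ex_eq, hcompl, hall, hcompl]
    map_all' := hall }⟩⟩

end MonadicMVAlgebra

theorem mainTheorem8 (A : Type u) [MonadicMVAlgebra A] (k : ℕ) (hk : 1 ≤ k)
    (hFSI : MonadicMVAlgebra.IsFSI A) (hwidth : MonadicMVAlgebra.HasWidth A k) :
    ∃ (V : Type u) (_ : MVChain V), Nonempty (MonadicMVEmbedding A (Fin k → V)) :=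
  MonadicMVAlgebra.IsFSI.exists_embedding_power hk hFSI hwidth
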